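/- Let $(Y,\|\cdot\|)$ be a real normed space of dimension at least $2$. A set $C\subseteq Y$ is a (not necessarily convex) cone if $0\in C=\mathbb R_+\cdot C$, and it is nontrivial if $\{0\}\ne C\ne Y$. For a norm $\psi$ on $Y$ and a cone $C$ put $$B_C(\psi)=\{x\in C:\psi(x)=1\},\qquad S_C(\psi)=\operatorname{conv}B_C(\psi),\qquad S^0_C(\psi)=\operatorname{conv}(\{0\}\cup B_C(\psi)).$$ Let $\operatorname{cl}$ and $\operatorname{cl}_w$ denote the closure in the norm topology and in the weak topology of $Y$. Let $K,A\subseteq Y$ be nontrivial cones such that $$A\cap\operatorname{cl}(\operatorname{conv}(-K))=\{0\}\qquad\text{and}\qquad 0\notin\operatorname{cl}S_{-K}(\|\cdot\|),$$ and assume that at least one of the following holds: (a) $B_A(\|\cdot\|)$ is compact; (b) $A$ is weakly closed, and either $Y$ is reflexive, or $\operatorname{cl}_w B_A(\|\cdot\|)$ is weakly compact with $0\notin\operatorname{cl}_w B_A(\|\cdot\|)$. Then there is a norm $\|\cdot\|'$ on $Y$ equivalent to $\|\cdot\|$ such that $$\operatorname{cl}S^0_A(\|\cdot\|')\cap\operatorname{cl}S_{-K}(\|\cdot\|')=\emptyset.$$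 -/

import Mathlib

open scoped Pointwise

namespace ConeSep

/-- A (not necessarily convex) cone: `0 ∈ K = ℝ₊ • K`. -/
def IsCone {Y : Type*} [AddCommGroup Y] [Module ℝ Y] (K : Set Y) : Prop :=
  (0 : Y) ∈ K ∧ K = Set.Ici (0 : ℝ) • K

/-- A nontrivial (proper) cone: `{0} ≠ K ≠ Y`. -/
def IsNontrivialCone {Y : Type*} [AddCommGroup Y] [Module ℝ Y] (K : Set Y) : Prop :=
  IsCone K ∧ K ≠ {0} ∧ K ≠ Set.univ

/-- `B_C(ψ) = {x ∈ C | ψ x = 1}`. When `ψ` is a norm this is the norm-base of `C`; the requirement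
that `ψ` be positive on `C \ {0}` is then automatic. -/
def normBase {Y : Type*} [AddCommGroup Y] [Module ℝ Y] (ψ : Seminorm ℝ Y) (C : Set Y) : Set Y :=
  {x | x ∈ C ∧ ψ x = 1}

/-- `S_C(ψ) = conv B_C(ψ)`. -/
def S {Y : Type*} [AddCommGroup Y] [Module ℝ Y] (ψ : Seminorm ℝ Y) (C : Set Y) : Set Y :=
  convexHull ℝ (normBase ψ C)

/-- `S_C^0(ψ) = conv ({0} ∪ B_C(ψ))`. -/
def S0 {Y : Type*} [AddCommGroup Y] [Module ℝ Y] (ψ : Seminorm ℝ Y) (C : Set Y) : Set Y :=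
  convexHull ℝ ({0} ∪ normBase ψ C)

/-- `p` is a norm on `Y` equivalent to the given norm (the lower bound makes `p` definite, and the
two bounds make the topology of `p` the topology of `Y`). -/
def IsEquivalentNorm {Y : Type*} [NormedAddCommGroup Y] [NormedSpace ℝ Y]
    (p : Seminorm ℝ Y) : Prop :=
  ∃ c C : ℝ, 0 < c ∧ 0 < C ∧ ∀ y : Y, c * ‖y‖ ≤ p y ∧ p y ≤ C * ‖y‖

/-- A real normed space is reflexive if the canonical map into its bidual is onto. -/
def IsReflexiveSpace (Y : Type*) [NormedAddCommGroup Y] [NormedSpace ℝ Y] : Prop :=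
  Function.Surjective (NormedSpace.inclusionInDoubleDual ℝ Y)

/-- The set `Ω`, viewed in `Y` endowed with the weak topology. -/
def inWeak {Y : Type*} [NormedAddCommGroup Y] [NormedSpace ℝ Y] (Ω : Set Y) :
    Set (WeakSpace ℝ Y) :=
  toWeakSpace ℝ Y '' Ω

end ConeSep

namespace ConeSep

open Set Metric

section Cone

variable {Y : Type*} [AddCommGroup Y] [Module ℝ Y]

/-! Let `C = closure (convexHull ℝ (-K))`. Hahn–Banach gives `f` with `d * ‖x‖ ≤ f x` on `C`, and
weak compactness gives a positive angle between `A` and `C` (`exists_pos_mul_norm_le_norm_sub`). The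
new norm `p` is the gauge of a small neighbourhood of the symmetrized slice `{f ≤ 1}` of `C`. Then
`p ≤ f` on `C`, while a point with `p x = 1` and `f x > 1 - η` must lie near `C`
(`exists_mem_norm_sub_le`), which the angle forbids on `A`. So `f ≤ 1 - η` on the base of `A` and `f
≥ 1` on that of `-K`. -/

theorem IsCone.smul_mem {K : Set Y} (hK : IsCone K) {t : ℝ} (ht : 0 ≤ t) {x : Y} (hx : x ∈ K) :
    t • x ∈ K := by
  rw [hK.2]
  exact smul_mem_smul ht hx

theorem IsCone.neg {K : Set Y} (hK : IsCone K) : IsCone (-K) := by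
  refine ⟨by simpa using hK.1, Subset.antisymm (fun x hx => ?_) ?_⟩
  · exact mem_smul.2 ⟨1, mem_Ici.2 zero_le_one, x, hx, one_smul _ _⟩
  · rintro _ ⟨t, ht, x, hx, rfl⟩
    simpa using hK.smul_mem ht hx

theorem IsCone.smul_mem_convexHull {K : Set Y} (hK : IsCone K) {t : ℝ} (ht : 0 ≤ t) {x : Y}
    (hx : x ∈ convexHull ℝ K) : t • x ∈ convexHull ℝ K := by
  have hsub : t • convexHull ℝ K ⊆ convexHull ℝ K := by
    rw [← convexHull_smul]
    apply convexHull_mono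
    rintro _ ⟨y, hy, rfl⟩
    exact hK.smul_mem ht hy
  exact hsub (smul_mem_smul_set hx)

end Cone

variable {Y : Type*} [NormedAddCommGroup Y] [NormedSpace ℝ Y]

theorem IsCone.smul_mem_closure_convexHull {K : Set Y} (hK : IsCone K) {t : ℝ} (ht : 0 ≤ t)
    {x : Y} (hx : x ∈ closure (convexHull ℝ K)) : t • x ∈ closure (convexHull ℝ K) :=
  map_mem_closure (continuous_const_smul t) hx fun _ hy => hK.smul_mem_convexHull ht hy

/-- If the closed convex hull of the norm base of a cone omits the origin, then some continuous
functional dominates a multiple of the norm on the closed convex hull of the cone. -/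
theorem exists_functional_ge_norm {K : Set Y} (hK : IsCone K)
    (h0 : (0 : Y) ∉ closure (S (normSeminorm ℝ Y) K)) :
    ∃ (f : StrongDual ℝ Y) (d : ℝ), 0 < d ∧ ∀ x ∈ closure (convexHull ℝ K), d * ‖x‖ ≤ f x := by
  obtain ⟨f, d, hd, hf⟩ :=
    geometric_hahn_banach_point_closed (convex_convexHull ℝ _).closure isClosed_closure h0
  rw [map_zero] at hd
  refine ⟨f, d, hd, fun x hx => ?_⟩
  -- The right-hand set is closed and convex because `d * ‖x‖ - f x` is continuous and convex, so it
  -- is enough to test `K`, hence unit vectors of `K`.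
  suffices hsub : closure (convexHull ℝ K) ⊆ {x | d * ‖x‖ ≤ f x} from hsub hx
  refine closure_minimal (convexHull_min (fun y hy => ?_) ?_)
    (isClosed_le (by fun_prop) (by fun_prop))
  · rcases eq_or_ne y 0 with rfl | hy0
    · simp
    · have hpos : 0 < ‖y‖ := norm_pos_iff.2 hy0
      have hlt := hf (‖y‖⁻¹ • y) (subset_closure (subset_convexHull ℝ _
        ⟨hK.smul_mem (inv_nonneg.2 hpos.le) hy, by
          simp [norm_smul, inv_mul_cancel₀ hpos.ne']⟩))
      rw [map_smul, smul_eq_mul, ← div_eq_inv_mul, lt_div_iff₀ hpos] at hlt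
      exact hlt.le
  · intro x hx y hy a b ha hb _
    simp only [mem_ofPred_eq, map_add, map_smul, smul_eq_mul] at hx hy ⊢
    have hn : ‖a • x + b • y‖ ≤ a * ‖x‖ + b * ‖y‖ := by
      simpa [norm_smul, abs_of_nonneg ha, abs_of_nonneg hb] using norm_add_le (a • x) (b • y)
    nlinarith [mul_le_mul_of_nonneg_left hn hd.le, mul_le_mul_of_nonneg_left hx ha,
      mul_le_mul_of_nonneg_left hy hb]

/-! ### Positive angle from weak compactness -/

/-- A weakly compact set has positive norm distance from a disjoint closed convex set. -/
theorem exists_pos_le_norm_sub {W : Set (WeakSpace ℝ Y)} (hW : IsCompact W) {C : Set Y}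
    (hC : Convex ℝ C) (hCc : IsClosed C) (hdisj : Disjoint W (inWeak C)) :
    ∃ ε > 0, ∀ x, toWeakSpace ℝ Y x ∈ W → ∀ c ∈ C, ε ≤ ‖x - c‖ := by
  have hCw : IsClosed (inWeak C) := by
    have h := hC.toWeakSpace_closure ℝ
    rw [hCc.closure_eq] at h
    rw [inWeak, h]
    exact isClosed_closure
  -- The difference set is weakly closed and omits 0, so its complement contains a norm ball about
  -- 0.
  have hcl : IsClosed (-inWeak C + W) := hCw.neg.add_right_of_isCompact hW
  have hopen : IsOpen ((toWeakSpaceCLM ℝ Y) ⁻¹' (-inWeak C + W)ᶜ) :=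
    hcl.isOpen_compl.preimage (toWeakSpaceCLM ℝ Y).continuous
  have hmem : (0 : Y) ∈ (toWeakSpaceCLM ℝ Y) ⁻¹' (-inWeak C + W)ᶜ := by
    rintro ⟨c, hc, w, hw, hcw⟩
    simp only [map_zero] at hcw
    rw [← neg_eq_of_add_eq_zero_right hcw] at hw
    exact disjoint_left.1 hdisj hw hc
  obtain ⟨ε, hε, hball⟩ := Metric.isOpen_iff.1 hopen 0 hmem
  refine ⟨ε, hε, fun x hx c hc => ?_⟩
  by_contra! hlt
  refine hball (a := x - c) (by simpa using hlt) ⟨-toWeakSpace ℝ Y c, ?_, toWeakSpace ℝ Y x, hx, ?_⟩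
  · exact Set.neg_mem_neg.2 (mem_image_of_mem _ hc)
  · simp [sub_eq_neg_add]

/-- Banach–Alaoglu in the bidual; reflexivity ensures that weak-star limits come from `Y`. -/
theorem IsReflexiveSpace.isCompact_closure_inWeak (hY : IsReflexiveSpace Y) {s : Set Y}
    (hs : Bornology.IsBounded s) : IsCompact (closure (inWeak s)) := by
  refine NormedSpace.isCompact_closure_of_isBounded ℝ Y _ ?_ fun z _ => ?_
  · rwa [inWeak, preimage_image_eq _ (toWeakSpace ℝ Y).injective]
  · obtain ⟨y, hy⟩ := hY (WeakDual.toStrongDual z)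
    exact ⟨toWeakSpace ℝ Y y, hy⟩

/-- A cone whose norm base has weakly compact closure inside the cone lies at a positive angle from
every closed convex cone `C` that meets it only at the origin and on which some continuous
functional dominates a multiple of the norm. -/
theorem exists_pos_mul_norm_le_norm_sub {A C : Set Y} (hA : IsCone A) (hC : Convex ℝ C)
    (hCc : IsClosed C) (hCs : ∀ t : ℝ, 0 ≤ t → ∀ x ∈ C, t • x ∈ C) (hAC : A ∩ C = {0})
    {f : StrongDual ℝ Y} {d : ℝ} (hd : 0 < d) (hf : ∀ x ∈ C, d * ‖x‖ ≤ f x)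
    (hcomp : IsCompact (closure (inWeak (normBase (normSeminorm ℝ Y) A))))
    (hsub : closure (inWeak (normBase (normSeminorm ℝ Y) A)) ⊆ inWeak A) :
    ∃ ε > 0, ∀ x ∈ A, ∀ c ∈ C, ε * ‖x‖ ≤ ‖x - c‖ := by
  -- The weak closure of the whole base may contain 0, which lies in `C`; the cut by `f` removes it.
  set B := normBase (normSeminorm ℝ Y) A ∩ {x | d / 2 ≤ f x}
  have hfw : closure (inWeak B) ⊆ inWeak {x | d / 2 ≤ f x} := by
    have hcl : IsClosed (inWeak {x | d / 2 ≤ f x}) := by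
      have hconv : Convex ℝ {x | d / 2 ≤ f x} :=
        convex_halfSpace_ge f.toLinearMap.isLinear _
      have h := hconv.toWeakSpace_closure ℝ
      rw [(isClosed_le continuous_const f.continuous).closure_eq] at h
      rw [inWeak, h]
      exact isClosed_closure
    exact closure_minimal (image_mono inter_subset_right) hcl
  have hdisj : Disjoint (closure (inWeak B)) (inWeak C) := by
    rw [disjoint_left]
    rintro _ hx ⟨c, hc, rfl⟩
    obtain ⟨a, ha, hac⟩ := hsub (closure_mono (image_mono inter_subset_left) hx)
    obtain ⟨b, hb, hbc⟩ := hfw hx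
    obtain rfl := (toWeakSpace ℝ Y).injective hac
    obtain rfl := (toWeakSpace ℝ Y).injective hbc
    have h0 : b ∈ ({0} : Set Y) := hAC ▸ ⟨ha, hc⟩
    rw [mem_singleton_iff.1 h0] at hb
    simp only [mem_ofPred_eq, map_zero] at hb
    linarith
  have hBcomp : IsCompact (closure (inWeak B)) :=
    hcomp.of_isClosed_subset isClosed_closure (closure_mono (image_mono inter_subset_left))
  obtain ⟨ε, hε, hdist⟩ := exists_pos_le_norm_sub hBcomp hC hCc hdisj
  have hF : 0 < ‖f‖ + d := by positivity
  refine ⟨min ε (d / 2 / (‖f‖ + d)), lt_min hε (by positivity), fun x hx c hc => ?_⟩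
  rcases eq_or_ne x 0 with rfl | hx0
  · simp
  have hpos : 0 < ‖x‖ := norm_pos_iff.2 hx0
  have hscale : ‖x - c‖ = ‖x‖ * ‖‖x‖⁻¹ • x - ‖x‖⁻¹ • c‖ := by
    rw [← smul_sub, norm_smul, norm_inv, norm_norm, mul_inv_cancel_left₀ hpos.ne']
  rw [hscale, mul_comm]
  refine mul_le_mul_of_nonneg_left ?_ hpos.le
  have hxA : ‖x‖⁻¹ • x ∈ normBase (normSeminorm ℝ Y) A :=
    ⟨hA.smul_mem (inv_nonneg.2 hpos.le) hx, by simp [norm_smul, inv_mul_cancel₀ hpos.ne']⟩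
  have hcC := hCs _ (inv_nonneg.2 hpos.le) c hc
  generalize ‖x‖⁻¹ • x = u at *
  generalize ‖x‖⁻¹ • c = v at *
  by_cases hu : d / 2 ≤ f u
  · exact (min_le_left _ _).trans
      (hdist u (subset_closure (mem_image_of_mem _ ⟨hxA, hu⟩)) v hcC)
  -- Off the cut, with `δ = ‖u - v‖`: `d * (1 - δ) ≤ f v ≤ f u + ‖f‖ * δ < d / 2 + ‖f‖ * δ`.
  · refine (min_le_right _ _).trans ?_
    rw [div_le_iff₀ hF]
    have hu1 : ‖u‖ = 1 := hxA.2
    have h1 : f (v - u) ≤ ‖f‖ * ‖v - u‖ := (le_abs_self _).trans (f.le_opNorm _)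
    rw [norm_sub_rev v u, map_sub] at h1
    have h2 := hf v hcC
    have h3 : ‖u‖ - ‖u - v‖ ≤ ‖v‖ := by
      have := norm_sub_norm_le u (u - v)
      simpa using this
    have h4 := mul_le_mul_of_nonneg_left h3 hd.le
    rw [hu1] at h4
    linarith

/-! ### The unit ball of the new norm -/

/-- The `η`-neighbourhood of the absolutely convex hull of the slice `{x ∈ C | f x ≤ 1}`. -/
def slabBall (C : Set Y) (f : StrongDual ℝ Y) (η : ℝ) : Set Y :=
  {x | ∃ a ∈ C, ∃ b ∈ C, f a + f b ≤ 1 ∧ ‖x - (a - b)‖ ≤ η}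

theorem convex_slabBall {C : Set Y} (hC : Convex ℝ C) (f : StrongDual ℝ Y) (η : ℝ) :
    Convex ℝ (slabBall C f η) := by
  rintro x ⟨a, ha, b, hb, hab, hx⟩ y ⟨a', ha', b', hb', hab', hy⟩ s t hs ht hst
  refine ⟨s • a + t • a', hC ha ha' hs ht hst, s • b + t • b', hC hb hb' hs ht hst, ?_, ?_⟩
  · simp only [map_add, map_smul, smul_eq_mul]
    nlinarith [mul_le_mul_of_nonneg_left hab hs, mul_le_mul_of_nonneg_left hab' ht]
  · have h : s • x + t • y - (s • a + t • a' - (s • b + t • b')) =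
        s • (x - (a - b)) + t • (y - (a' - b')) := by module
    rw [h]
    refine (norm_add_le _ _).trans ?_
    rw [norm_smul, norm_smul, Real.norm_of_nonneg hs, Real.norm_of_nonneg ht]
    calc s * ‖x - (a - b)‖ + t * ‖y - (a' - b')‖ ≤ s * η + t * η :=
          add_le_add (mul_le_mul_of_nonneg_left hx hs) (mul_le_mul_of_nonneg_left hy ht)
      _ = η := by rw [← add_mul, hst, one_mul]

theorem closedBall_subset_slabBall {C : Set Y} (hC0 : (0 : Y) ∈ C) (f : StrongDual ℝ Y) (η : ℝ) :
    closedBall 0 η ⊆ slabBall C f η := fun x hx =>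
  ⟨0, hC0, 0, hC0, by simp, by simpa using hx⟩

theorem balanced_slabBall {C : Set Y} (hC : Convex ℝ C) (hC0 : (0 : Y) ∈ C) (f : StrongDual ℝ Y)
    {η : ℝ} (hη : 0 ≤ η) : Balanced ℝ (slabBall C f η) := by
  have hneg : ∀ x ∈ slabBall C f η, -x ∈ slabBall C f η := by
    rintro x ⟨a, ha, b, hb, hab, hx⟩
    refine ⟨b, hb, a, ha, by linarith, ?_⟩
    rwa [← norm_neg, show -(-x - (b - a)) = x - (a - b) by abel]
  have hzero : (0 : Y) ∈ slabBall C f η :=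
    closedBall_subset_slabBall hC0 f η (mem_closedBall_self hη)
  rw [balanced_iff_smul_mem]
  intro t ht x hx
  rw [Real.norm_eq_abs] at ht
  rcases le_total 0 t with h | h
  · rw [abs_of_nonneg h] at ht
    exact (convex_slabBall hC f η).smul_mem_of_zero_mem hzero hx ⟨h, ht⟩
  · rw [abs_of_nonpos h] at ht
    have := (convex_slabBall hC f η).smul_mem_of_zero_mem hzero (hneg x hx)
      ⟨neg_nonneg.2 h, ht⟩
    simpa using this

/-- Boundedness comes from `d * (‖a‖ + ‖b‖) ≤ f a + f b ≤ 1`; it makes the gauge definite. -/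
theorem slabBall_subset_closedBall {C : Set Y} {f : StrongDual ℝ Y} {d : ℝ} (hd : 0 < d)
    (hf : ∀ x ∈ C, d * ‖x‖ ≤ f x) (η : ℝ) : slabBall C f η ⊆ closedBall 0 (1 / d + η) := by
  rintro x ⟨a, ha, b, hb, hab, hx⟩
  have h1 : ‖a‖ + ‖b‖ ≤ 1 / d := by
    rw [le_div_iff₀ hd]
    linarith [hf a ha, hf b hb]
  have h2 : ‖x‖ ≤ ‖x - (a - b)‖ + ‖a - b‖ := by
    simpa using norm_add_le (x - (a - b)) (a - b)
  rw [mem_closedBall_zero_iff]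
  linarith [norm_sub_le a b]

theorem gauge_slabBall_le {C : Set Y} (hC0 : (0 : Y) ∈ C)
    (hCs : ∀ t : ℝ, 0 ≤ t → ∀ x ∈ C, t • x ∈ C) {f : StrongDual ℝ Y} {d : ℝ} (hd : 0 < d)
    (hf : ∀ x ∈ C, d * ‖x‖ ≤ f x) {η : ℝ} (hη : 0 ≤ η) {x : Y} (hx : x ∈ C) :
    gauge (slabBall C f η) x ≤ f x := by
  rcases eq_or_ne x 0 with rfl | hx0
  · simp
  have hpos : 0 < f x := (mul_pos hd (norm_pos_iff.2 hx0)).trans_le (hf x hx)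
  refine gauge_le_of_mem hpos.le ((mem_smul_set_iff_inv_smul_mem₀ hpos.ne' _ _).2 ?_)
  refine ⟨(f x)⁻¹ • x, hCs _ (inv_nonneg.2 hpos.le) x hx, 0, hC0, ?_, by simpa using hη⟩
  simp [inv_mul_cancel₀ hpos.ne']

/-- Points on which `f` nearly attains the gauge of `slabBall C f η` are close to `C`. -/
theorem exists_mem_norm_sub_le {C : Set Y} (hC0 : (0 : Y) ∈ C)
    (hCs : ∀ t : ℝ, 0 ≤ t → ∀ x ∈ C, t • x ∈ C) {f : StrongDual ℝ Y} {d : ℝ} (hd : 0 < d)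
    (hf : ∀ x ∈ C, d * ‖x‖ ≤ f x) {η : ℝ} (hη : 0 < η) (hη1 : η ≤ 1) {x : Y}
    (hx : gauge (slabBall C f η) x = 1) (hfx : 1 - η < f x) :
    ∃ c ∈ C, ‖x - c‖ ≤ 2 * η * ((3 + ‖f‖) / d + 1) := by
  have habs : Absorbent ℝ (slabBall C f η) :=
    (absorbent_nhds_zero (closedBall_mem_nhds 0 hη)).mono (closedBall_subset_slabBall hC0 f η)
  -- The gauge need not be attained, hence the slack `1 + η`.
  obtain ⟨t, ht0, ht, z, ⟨a, ha, b, hb, hab, hz⟩, rfl⟩ :=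
    exists_lt_of_gauge_lt habs (a := 1 + η) (by rw [hx]; linarith)
  simp only [map_smul, smul_eq_mul] at hfx
  refine ⟨t • a, hCs t ht0.le a ha, ?_⟩
  have h1 : f (z - (a - b)) ≤ ‖f‖ * η :=
    (le_abs_self _).trans ((f.le_opNorm _).trans (mul_le_mul_of_nonneg_left hz (norm_nonneg f)))
  simp only [map_sub] at h1
  have hfz : 1 - 2 * η < f z := by
    by_contra! hle
    rcases le_total 0 (f z) with h | h
    · nlinarith
    · nlinarith
  -- Since `f a + f b ≤ 1` and `f a - f b` is nearly 1, `f b` is of order `η`; so `b` is small and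
  -- `z` is near `a`.
  have hfb : f b ≤ (3 + ‖f‖) * η := by
    nlinarith [norm_nonneg f, (mul_nonneg hd.le (norm_nonneg b)).trans (hf b hb)]
  have hnb : ‖b‖ ≤ (3 + ‖f‖) / d * η := by
    rw [div_mul_eq_mul_div, le_div_iff₀ hd]
    linarith [hf b hb]
  have h2 : ‖z - a‖ ≤ η + (3 + ‖f‖) / d * η := by
    have h3 : ‖z - a‖ ≤ ‖z - (a - b)‖ + ‖b‖ := by
      have := norm_sub_le (z - (a - b)) b
      rwa [show z - (a - b) - b = z - a by abel] at this
    linarith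
  show ‖t • z - t • a‖ ≤ _
  rw [← smul_sub, norm_smul, Real.norm_of_nonneg ht0.le]
  calc t * ‖z - a‖ ≤ 2 * (η + (3 + ‖f‖) / d * η) :=
        mul_le_mul (by linarith) h2 (norm_nonneg _) (by norm_num)
    _ = _ := by ring

/-- A cone at a positive angle from a closed convex cone with a bounded base is separated from it,
in the sense of norm bases, by an equivalent norm. -/
theorem exists_equivalentNorm_separating {A C : Set Y} (hC : Convex ℝ C) (hC0 : (0 : Y) ∈ C)
    (hCs : ∀ t : ℝ, 0 ≤ t → ∀ x ∈ C, t • x ∈ C) {f : StrongDual ℝ Y} {d : ℝ} (hd : 0 < d)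
    (hf : ∀ x ∈ C, d * ‖x‖ ≤ f x) {ε : ℝ} (hε : 0 < ε)
    (hAC : ∀ x ∈ A, ∀ c ∈ C, ε * ‖x‖ ≤ ‖x - c‖) :
    ∃ (p : Seminorm ℝ Y) (r : ℝ), IsEquivalentNorm p ∧ 0 ≤ r ∧ r < 1 ∧
      (∀ x ∈ C, p x ≤ f x) ∧ ∀ x ∈ A, p x = 1 → f x ≤ r := by
  set M := (3 + ‖f‖) / d + 1
  have hM0 : 0 < M := by positivity
  set F := ‖f‖ + 1 with hF
  have hF0 : 0 < F := by positivity
  -- If `f x > 1 - η ≥ 1 / 2`, then `F * ‖x‖ > 1 / 2`, so `ε / 2 < F * (ε * ‖x‖) ≤ 2 * F * M * η ≤ ε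
  -- / 4`, a contradiction.
  set η := min (1 / 2) (ε / (8 * F * M))
  have hη : 0 < η := lt_min (by norm_num) (by positivity)
  have hη2 : η ≤ 1 / 2 := min_le_left _ _
  have hη3 : 8 * F * M * η ≤ ε := by
    have h : η ≤ ε / (8 * F * M) := min_le_right _ _
    rw [le_div_iff₀ (by positivity)] at h
    linarith
  have hball := closedBall_subset_slabBall hC0 f η
  have habs : Absorbent ℝ (slabBall C f η) :=
    (absorbent_nhds_zero (closedBall_mem_nhds 0 hη)).mono hball
  have hR : 0 < 1 / d + η := by positivity
  refine ⟨gaugeSeminorm (balanced_slabBall hC hC0 f hη.le) (convex_slabBall hC f η) habs, 1 - η,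
    ⟨(1 / d + η)⁻¹, η⁻¹, by positivity, by positivity, fun y => ⟨?_, ?_⟩⟩, by linarith,
    by linarith, fun x hx => gauge_slabBall_le hC0 hCs hd hf hη.le hx, fun x hx hpx => ?_⟩
  · rw [← div_eq_inv_mul]
    exact le_gauge_of_subset_closedBall habs hR.le (slabBall_subset_closedBall hd hf η)
  · rw [← div_eq_inv_mul, le_div_iff₀ hη, mul_comm]
    exact mul_gauge_le_norm (ball_subset_closedBall.trans hball)
  · by_contra! hlt
    obtain ⟨c, hc, hxc⟩ := exists_mem_norm_sub_le hC0 hCs hd hf hη (by linarith) hpx hlt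
    have h1 := hAC x hx c hc
    have h2 : f x ≤ ‖f‖ * ‖x‖ := (le_abs_self _).trans (f.le_opNorm x)
    have h3 : 1 / 2 < F * ‖x‖ := by
      rw [hF]
      nlinarith [norm_nonneg x]
    have h4 : F * (ε * ‖x‖) ≤ F * (2 * η * M) :=
      mul_le_mul_of_nonneg_left (h1.trans hxc) hF0.le
    nlinarith

/-- A functional separating the norm bases separates their closed convex hulls. -/
theorem closure_S0_inter_closure_S_eq_empty {A K : Set Y} {p : Seminorm ℝ Y}
    {f : StrongDual ℝ Y} {r : ℝ} (hr0 : 0 ≤ r) (hr1 : r < 1) (hK : ∀ x ∈ K, p x ≤ f x)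
    (hA : ∀ x ∈ A, p x = 1 → f x ≤ r) : closure (S0 p A) ∩ closure (S p K) = ∅ := by
  have h1 : closure (S0 p A) ⊆ {x | f x ≤ r} := by
    refine closure_minimal (convexHull_min ?_ (convex_halfSpace_le f.toLinearMap.isLinear _))
      (isClosed_le f.continuous continuous_const)
    rintro x (rfl | hx)
    · simpa using hr0
    · exact hA x hx.1 hx.2
  have h2 : closure (S p K) ⊆ {x | 1 ≤ f x} := by
    refine closure_minimal (convexHull_min ?_ (convex_halfSpace_ge f.toLinearMap.isLinear _))
      (isClosed_le continuous_const f.continuous)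
    intro x hx
    exact hx.2 ▸ hK x hx.1
  refine eq_empty_of_forall_notMem fun x hx => ?_
  have h3 : f x ≤ r := h1 hx.1
  have h4 : 1 ≤ f x := h2 hx.2
  linarith

/-- The norm base of `A` has weakly compact closure inside `A` if it is compact, or if `A` is weakly
closed and the space is reflexive or the base is relatively weakly compact. -/
theorem isCompact_closure_inWeak_normBase {A : Set Y}
    (hab : IsCompact (normBase (normSeminorm ℝ Y) A) ∨
      (IsClosed (inWeak A) ∧
        (IsReflexiveSpace Y ∨ IsCompact (closure (inWeak (normBase (normSeminorm ℝ Y) A)))))) :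
    IsCompact (closure (inWeak (normBase (normSeminorm ℝ Y) A))) ∧
      closure (inWeak (normBase (normSeminorm ℝ Y) A)) ⊆ inWeak A := by
  have hBA : inWeak (normBase (normSeminorm ℝ Y) A) ⊆ inWeak A := image_mono fun x hx => hx.1
  rcases hab with hcomp | ⟨hclosed, h⟩
  · have hw : IsCompact (inWeak (normBase (normSeminorm ℝ Y) A)) :=
      hcomp.image (toWeakSpaceCLM ℝ Y).continuous
    rw [hw.isClosed.closure_eq]
    exact ⟨hw, hBA⟩
  · refine ⟨?_, closure_minimal hBA hclosed⟩
    rcases h with hY | hcomp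
    · refine hY.isCompact_closure_inWeak ((isBounded_closedBall (x := (0 : Y)) (r := 1)).subset ?_)
      intro x hx
      have h1 : ‖x‖ = 1 := hx.2
      simp [h1]
    · exact hcomp

end ConeSep

theorem mainTheorem10 {Y : Type*} [NormedAddCommGroup Y] [NormedSpace ℝ Y]
    (hdim : 2 ≤ Module.rank ℝ Y)
    (K A : Set Y) (hK : ConeSep.IsNontrivialCone K) (hA : ConeSep.IsNontrivialCone A)
    (hAK : A ∩ closure (convexHull ℝ (-K)) = {0})
    (h0 : (0 : Y) ∉ closure (ConeSep.S (normSeminorm ℝ Y) (-K)))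
    (hab : IsCompact (ConeSep.normBase (normSeminorm ℝ Y) A) ∨
      (IsClosed (ConeSep.inWeak A) ∧
        (ConeSep.IsReflexiveSpace Y ∨
          (IsCompact (closure (ConeSep.inWeak (ConeSep.normBase (normSeminorm ℝ Y) A))) ∧
            (0 : WeakSpace ℝ Y) ∉
              closure (ConeSep.inWeak (ConeSep.normBase (normSeminorm ℝ Y) A)))))) :
    ∃ p : Seminorm ℝ Y, ConeSep.IsEquivalentNorm p ∧
      closure (ConeSep.S0 p A) ∩ closure (ConeSep.S p (-K)) = ∅ := by
  have hKn : ConeSep.IsCone (-K) := hK.1.neg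
  obtain ⟨f, d, hd, hf⟩ := ConeSep.exists_functional_ge_norm hKn h0
  obtain ⟨hcomp, hsub⟩ := ConeSep.isCompact_closure_inWeak_normBase
    (hab.imp_right (And.imp_right (Or.imp_right And.left)))
  have hC : Convex ℝ (closure (convexHull ℝ (-K))) := (convex_convexHull ℝ _).closure
  have hKC : -K ⊆ closure (convexHull ℝ (-K)) := (subset_convexHull ℝ _).trans subset_closure
  have hCs : ∀ t : ℝ, 0 ≤ t → ∀ x ∈ closure (convexHull ℝ (-K)),
      t • x ∈ closure (convexHull ℝ (-K)) :=
    fun t ht x hx => hKn.smul_mem_closure_convexHull ht hx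
  obtain ⟨ε, hε, hdist⟩ := ConeSep.exists_pos_mul_norm_le_norm_sub hA.1 hC isClosed_closure hCs
    hAK hd hf hcomp hsub
  obtain ⟨p, r, hp, hr0, hr1, hpC, hpA⟩ :=
    ConeSep.exists_equivalentNorm_separating hC (hKC hKn.1) hCs hd hf hε hdist
  exact ⟨p, hp, ConeSep.closure_S0_inter_closure_S_eq_empty hr0 hr1
    (fun x hx => hpC x (hKC hx)) hpA⟩
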